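/- Let $K,\kappa\in\mathbb N$ and $C,c>0$ be constants. Let $\hat H=\sum_{j=1}^m\hat H_j$ be a $K$-local Hamiltonian on $n$ qubits: each $\hat H_j$ is Hermitian with operator norm $\|\hat H_j\|\le 1$ and acts non-trivially on at most $K$ qubits, each qubit is acted upon non-trivially by at most $K$ of the terms, and $m\le Cn$. For a state $\rho=\sum_i\lambda_i|\psi_i\rangle\langle\psi_i|$ the quantum Fisher information (for the evolution $e^{-i\theta\hat H/2}$) is $$\mathcal F(\rho,\hat H)=\frac12\sum_{\lambda_i+\lambda_j\ne0}\frac{(\lambda_i-\lambda_j)^2}{\lambda_i+\lambda_j}\,|\langle\psi_i|\hat H|\psi_j\rangle|^2 .$$ Let $\rho$ be a state with optimal quantum Fisher information, in either of the following senses: (i) $\rho$ attains the optimal (Heisenberg) scaling, $\mathcal F(\rho,\hat H)\ge c\,n^2$; or (ii) $\rho$ maximizes $\mathcal F(\cdot,\hat H)$ among all $n$-qubit states, where $\lambda_{\max}(\hat H)-\lambda_{\min}(\hat H)\ge c\,n$. The circuit complexity of $\rho$ is the minimal depth $t$ (or $\infty$) of a circuit $\mathcal C_t\circ\cdots\circ\mathcal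 C_1$ with $\rho=\mathcal C_t\circ\cdots\circ\mathcal C_1(|0^n\rangle\langle 0^n|)$, where each layer $\mathcal C_l$ is a product of quantum channels (gates) acting on the blocks of a partition of the qubits. Then: 1. (All-to-all connectivity: each gate acts on at most $\kappa$ arbitrary qubits.) The circuit complexity of $\rho$ is $\Omega(\log n)$. 2. ($r$-dimensional systems, $r\ge1$: the qubits sit at distinct points of the lattice $\mathbb Z^r$ and each gate acts on qubits inside a hypercube of $\kappa\times\cdots\times\kappa$ lattice points.) The circuit complexity of $\rho$ is $\Omega(n^{1/r})$. The implied constant and the threshold for $n$ depend only on $K,\kappa,C,c$ (and, in 2, on $r$), and not on the Hamiltonian, the state or the placement of the qubits. -/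

import Mathlib

open scoped ENNReal ComplexOrder Matrix.Norms.L2Operator

noncomputable section

namespace Metrology

/-- Operators on `n` qubits, as matrices in the computational basis `{0,1}^n`. -/
abbrev Op (n : ℕ) : Type := Matrix (Fin n → Fin 2) (Fin n → Fin 2) ℂ

/-- The operator `M ⊗ 𝟙` on `n` qubits, where `M` is an operator on the qubits in `A` and the
identity acts on the other qubits. -/
def embed {n : ℕ} (A : Finset (Fin n)) (M : Matrix (A → Fin 2) (A → Fin 2) ℂ) : Op n :=
  Matrix.of fun x y =>
    if ∀ i, i ∉ A → x i = y i then M (fun i => x i) (fun i => y i) else 0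

/-- `O = O_A ⊗ 𝟙` for some operator `O_A` on the qubits in `A`. -/
def ActsOn {n : ℕ} (A : Finset (Fin n)) (O : Op n) : Prop :=
  ∃ M : Matrix (A → Fin 2) (A → Fin 2) ℂ, O = embed A M

open Classical in
/-- The support of `O`: the smallest set `A` of qubits with `O = O_A ⊗ 𝟙`
(the intersection of all such sets). -/
def supp {n : ℕ} (O : Op n) : Finset (Fin n) :=
  Finset.univ.filter fun i => ∀ A : Finset (Fin n), ActsOn A O → i ∈ A

/-- A `K`-local Hamiltonian `H = ∑ j, H_j` on `n` qubits, with its decomposition into `m` terms: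
each term is Hermitian, of operator norm at most one, acts on at most `K` qubits, and every qubit
lies in the support of at most `K` terms (counted with multiplicity). -/
structure LocalHamiltonian (K n : ℕ) where
  m : ℕ
  term : Fin m → Op n
  isHermitian_term : ∀ j, (term j).IsHermitian
  norm_term_le : ∀ j, ‖term j‖ ≤ 1
  card_supp_le : ∀ j, (supp (term j)).card ≤ K
  degree_le : ∀ i : Fin n, (Finset.univ.filter fun j => i ∈ supp (term j)).card ≤ K

/-- The total Hamiltonian. -/
def LocalHamiltonian.op {K n : ℕ} (H : LocalHamiltonian K n) : Op n := ∑ j, H.term j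

theorem LocalHamiltonian.isHermitian_op {K n : ℕ} (H : LocalHamiltonian K n) :
    H.op.IsHermitian :=
  isSelfAdjoint_sum _ fun j _ => H.isHermitian_term j

/-- A (possibly mixed) state of `n` qubits. -/
structure QState (n : ℕ) where
  mat : Op n
  posSemidef : mat.PosSemidef
  trace_eq_one : mat.trace = 1

/-- The quantum Fisher information of `ρ = ∑ i, λ_i |ψ_i⟩⟨ψ_i|` for the evolution
`exp (-i θ O / 2)`:
`1/2 * ∑_{λ_i + λ_j ≠ 0} (λ_i - λ_j)^2 / (λ_i + λ_j) * |⟨ψ_i| O |ψ_j⟩|^2`. -/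
def qfi {n : ℕ} (ρ : QState n) (O : Op n) : ℝ :=
  let ev := ρ.posSemidef.isHermitian.eigenvalues
  let ψ := ρ.posSemidef.isHermitian.eigenvectorBasis
  1 / 2 * ∑ i, ∑ j,
    if ev i + ev j ≠ 0 then
      (ev i - ev j) ^ 2 / (ev i + ev j) * ‖star (ψ i).ofLp ⬝ᵥ O.mulVec (ψ j).ofLp‖ ^ 2
    else 0

/-- `ρ` maximizes the quantum Fisher information with respect to `O` among all states. -/
def IsMaxQFI {n : ℕ} (O : Op n) (ρ : QState n) : Prop :=
  ∀ σ : QState n, qfi σ O ≤ qfi ρ O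

/-- The width of the spectrum of `H` (largest minus smallest eigenvalue) is at least `w`. -/
def SpectralWidthGE {K n : ℕ} (H : LocalHamiltonian K n) (w : ℝ) : Prop :=
  ∃ i j, w ≤ H.isHermitian_op.eigenvalues i - H.isHermitian_op.eigenvalues j

/-- `ρ` has optimal quantum Fisher information for `H`, with constant `c`: either it attains the
optimal (Heisenberg) scaling, with value at least `c n²`, or it is a maximizer of the quantum
Fisher information for `H`, where `H` has spectral width at least `c n`. -/
def HasOptimalQFI {K n : ℕ} (c : ℝ) (H : LocalHamiltonian K n) (ρ : QState n) : Prop :=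
  c * (n : ℝ) ^ 2 ≤ qfi ρ H.op ∨ (SpectralWidthGE H (c * n) ∧ IsMaxQFI H.op ρ)

/-- The pure state `|0…0⟩⟨0…0|`. -/
def zeroState (n : ℕ) : Op n := Matrix.single 0 0 1

/-- `Φ` is a quantum channel acting on the qubits in `B` only, with Kraus operators `k a`
on these qubits. -/
def IsGate {n : ℕ} (B : Finset (Fin n)) (Φ : Module.End ℂ (Op n)) : Prop :=
  ∃ (s : ℕ) (k : Fin s → Matrix (B → Fin 2) (B → Fin 2) ℂ),
    ∑ a, (k a).conjTranspose * k a = 1 ∧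
    ∀ X, Φ X = ∑ a, embed B (k a) * X * (embed B (k a)).conjTranspose

/-- A layer of gates: the qubits are partitioned into blocks, each of them satisfying the locality
constraint `allowed`, and `Φ` is the product of channels, one on each block (these commute, so the
order of the product is irrelevant). -/
def IsLayer {n : ℕ} (allowed : Finset (Fin n) → Prop) (Φ : Module.End ℂ (Op n)) : Prop :=
  ∃ (P : Finpartition (Finset.univ : Finset (Fin n)))
    (G : Finset (Fin n) → Module.End ℂ (Op n)),
    (∀ B ∈ P.parts, allowed B ∧ IsGate B (G B)) ∧ Φ = (P.parts.toList.map G).prod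

/-- `ρ = (C_t ∘ ⋯ ∘ C_1) (|0…0⟩⟨0…0|)` for `t` layers (the list is `[C_t, …, C_1]`). -/
def PreparableInDepth {n : ℕ} (allowed : Finset (Fin n) → Prop) (t : ℕ) (ρ : QState n) : Prop :=
  ∃ C : List (Module.End ℂ (Op n)),
    C.length = t ∧ (∀ Φ ∈ C, IsLayer allowed Φ) ∧ C.prod (zeroState n) = ρ.mat

/-- The circuit complexity of `ρ`: the minimal depth of a circuit that prepares it
(`⊤` if there is none). -/
def circuitComplexity {n : ℕ} (allowed : Finset (Fin n) → Prop) (ρ : QState n) : ℕ∞ :=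
  ⨅ (t : ℕ) (_ : PreparableInDepth allowed t ρ), (t : ℕ∞)

/-- All-to-all connectivity: a gate may act on any `κ` qubits. -/
def AllToAll {n : ℕ} (κ : ℕ) (B : Finset (Fin n)) : Prop := B.card ≤ κ

/-- Connectivity of an `r`-dimensional system, qubit `i` being located at the lattice point
`pos i`: a gate may act on qubits inside a hypercube of side length `κ` (that is, with `κ` lattice
points along each direction). -/
def GridLocal {n r : ℕ} (pos : Fin n → Fin r → ℤ) (κ : ℕ) (B : Finset (Fin n)) : Prop :=
  ∃ corner : Fin r → ℤ, ∀ i ∈ B, ∀ d, corner d ≤ pos i d ∧ pos i d < corner d + κ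

end Metrology

end

/-! The quantum Fisher information, in this normalisation, is at most the variance of the
Hamiltonian (`qfi_le_variance`), and the variance is the sum of the covariances of pairs of local
terms. A shallow circuit creates correlations only inside light cones: after `t` layers each qubit
is linked to at most `D` qubits, with `D = κ ^ (2 * t)` in the all-to-all case and `D = (4 * κ * t +
1) ^ r` on the lattice. Terms with unlinked supports have covariance zero (`exists_uncorrelated`),
so each term is correlated with at most `K ^ 2 * D` others and the variance is `O(D * n)`
(`variance_le`).

Optimality forces the Fisher information to be of order `n ^ 2`. This is the assumption in case (i);
in case (ii) a maximizer does at least as well as the equal superposition of two eigenvectors whose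
eigenvalues differ by `w ≥ c * n`, which gives `w ^ 2 / 4` (`qfi_superposition`). Hence `n ≤ A * D`
for a constant `A`, and solving for `t` gives both bounds. -/

namespace Metrology

open Matrix

variable {n : ℕ}

/-! ### Operators tensored with the identity -/

section Embed

theorem embed_eq_submatrix (A : Finset (Fin n)) (M : Matrix (A → Fin 2) (A → Fin 2) ℂ) :
    embed A M =
      (Matrix.kroneckerMap (· * ·) M (1 : Matrix ({i // i ∉ A} → Fin 2) _ ℂ)).submatrix
        (Equiv.piEquivPiSubtypeProd (· ∈ A) fun _ => Fin 2)
        (Equiv.piEquivPiSubtypeProd (· ∈ A) fun _ => Fin 2) := by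
  ext x y
  simp only [embed, Matrix.of_apply, Matrix.submatrix_apply, Matrix.kroneckerMap_apply,
    Equiv.piEquivPiSubtypeProd_apply, Matrix.one_apply, funext_iff, Subtype.forall]
  split_ifs <;> simp

theorem embed_mul (A : Finset (Fin n)) (M N : Matrix (A → Fin 2) (A → Fin 2) ℂ) :
    embed A (M * N) = embed A M * embed A N := by
  simp only [embed_eq_submatrix, Matrix.submatrix_mul_equiv, ← Matrix.mul_kronecker_mul, mul_one]

theorem embed_one (A : Finset (Fin n)) : embed A 1 = 1 := by
  simp only [embed_eq_submatrix, Matrix.one_kronecker_one, Matrix.submatrix_one_equiv]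

theorem embed_conjTranspose (A : Finset (Fin n)) (M : Matrix (A → Fin 2) (A → Fin 2) ℂ) :
    embed A M.conjTranspose = (embed A M).conjTranspose := by
  simp only [embed_eq_submatrix, Matrix.conjTranspose_submatrix, Matrix.conjTranspose_kronecker,
    Matrix.conjTranspose_one]

theorem embed_sum (A : Finset (Fin n)) {ι : Type*} (s : Finset ι)
    (M : ι → Matrix (A → Fin 2) (A → Fin 2) ℂ) :
    embed A (∑ a ∈ s, M a) = ∑ a ∈ s, embed A (M a) := by
  ext x y
  simp only [embed, Matrix.of_apply, Matrix.sum_apply]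
  split_ifs <;> simp

end Embed

/-! ### Supports of operators -/

section ActsOn

/-- In terms of entries, intersecting or enlarging `A` becomes a comparison of bit strings, with no
operator on a subset to construct. -/
theorem actsOn_iff {A : Finset (Fin n)} {O : Op n} :
    ActsOn A O ↔ (∀ x y, ∀ i ∉ A, x i ≠ y i → O x y = 0) ∧
      ∀ x y x' y', (∀ i ∉ A, x i = y i) → (∀ i ∉ A, x' i = y' i) → (∀ i ∈ A, x i = x' i) →
        (∀ i ∈ A, y i = y' i) → O x y = O x' y' := by
  constructor
  · rintro ⟨M, rfl⟩
    refine ⟨fun x y i hi h => ?_, fun x y x' y' h h' hx hy => ?_⟩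
    · rw [embed, Matrix.of_apply, if_neg fun H => h (H i hi)]
    · have e₁ : (fun i : A => x i) = fun i : A => x' i := funext fun i => hx i i.2
      have e₂ : (fun i : A => y i) = fun i : A => y' i := funext fun i => hy i i.2
      rw [embed, Matrix.of_apply, Matrix.of_apply, if_pos h, if_pos h', e₁, e₂]
  · rintro ⟨h₀, h₁⟩
    refine ⟨Matrix.of fun x y => O (fun i => if h : i ∈ A then x ⟨i, h⟩ else 0)
      (fun i => if h : i ∈ A then y ⟨i, h⟩ else 0), ?_⟩
    ext x y
    simp only [embed, Matrix.of_apply]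
    split_ifs with h
    · apply h₁ _ _ _ _ h <;> simp +contextual
    · push Not at h
      obtain ⟨i, hi, h⟩ := h
      exact h₀ x y i hi h

theorem actsOn_embed (A : Finset (Fin n)) (M : Matrix (A → Fin 2) (A → Fin 2) ℂ) :
    ActsOn A (embed A M) := ⟨M, rfl⟩

theorem actsOn_univ (O : Op n) : ActsOn Finset.univ O :=
  actsOn_iff.2 ⟨fun _ _ i hi => absurd (Finset.mem_univ i) hi, fun x y x' y' _ _ hx hy => by
    rw [funext fun i => hx i (Finset.mem_univ i), funext fun i => hy i (Finset.mem_univ i)]⟩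

theorem ActsOn.inter {A B : Finset (Fin n)} {O : Op n} (hA : ActsOn A O) (hB : ActsOn B O) :
    ActsOn (A ∩ B) O := by
  classical
  rw [actsOn_iff] at *
  refine ⟨fun x y i hi h => ?_, fun x y x' y' h h' hx hy => ?_⟩
  · by_cases hiA : i ∈ A
    · exact hB.1 x y i (fun hiB => hi (Finset.mem_inter.2 ⟨hiA, hiB⟩)) h
    · exact hA.1 x y i hiA h
  · simp only [Finset.mem_inter] at h h' hx hy
    -- Pass through hybrid strings: they agree with `x, y` on `A`, and with `x', y'` on `B`.
    rw [hA.2 x y (fun i => if i ∈ A then x i else x' i) (fun i => if i ∈ A then y i else y' i)]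
    · apply hB.2 <;> grind
    all_goals grind

theorem ActsOn.mono {A B : Finset (Fin n)} {O : Op n} (hA : ActsOn A O) (h : A ⊆ B) :
    ActsOn B O := by
  rw [actsOn_iff] at *
  refine ⟨fun x y i hi => hA.1 x y i fun hi' => hi (h hi'), fun x y x' y' H H' hx hy => ?_⟩
  by_cases hxy : ∀ i ∉ A, x i = y i
  · refine hA.2 _ _ _ _ hxy (fun i hi => ?_) (fun i hi => hx i (h hi)) fun i hi => hy i (h hi)
    by_cases hB : i ∈ B
    · rw [← hx i hB, ← hy i hB, hxy i hi]
    · exact H' i hB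
  · push Not at hxy
    obtain ⟨i, hi, hne⟩ := hxy
    have hB : i ∈ B := by by_contra hB; exact hne (H i hB)
    rw [hA.1 x y i hi hne, hA.1 x' y' i hi]
    rwa [← hx i hB, ← hy i hB]

theorem actsOn_supp (O : Op n) : ActsOn (supp O) O := by
  classical
  have h : ActsOn ((Finset.univ.filter fun A : Finset (Fin n) => ActsOn A O).inf id) O :=
    Finset.inf_induction (p := fun A => ActsOn A O) (actsOn_univ O)
      (fun _ h₁ _ h₂ => ActsOn.inter h₁ h₂) fun A hA => (Finset.mem_filter.1 hA).2
  refine h.mono fun i hi => ?_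
  rw [supp, Finset.mem_filter]
  refine ⟨Finset.mem_univ i, fun A hA => ?_⟩
  exact Finset.inf_le (f := id) (Finset.mem_filter.2 ⟨Finset.mem_univ A, hA⟩) hi

theorem ActsOn.mul {A : Finset (Fin n)} {O O' : Op n} (h : ActsOn A O) (h' : ActsOn A O') :
    ActsOn A (O * O') := by
  obtain ⟨M, rfl⟩ := h
  obtain ⟨M', rfl⟩ := h'
  exact ⟨M * M', (embed_mul A M M').symm⟩

theorem ActsOn.conjTranspose {A : Finset (Fin n)} {O : Op n} (h : ActsOn A O) :
    ActsOn A O.conjTranspose := by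
  obtain ⟨M, rfl⟩ := h
  exact ⟨M.conjTranspose, (embed_conjTranspose A M).symm⟩

theorem ActsOn.sum {A : Finset (Fin n)} {ι : Type*} {s : Finset ι} {O : ι → Op n}
    (h : ∀ a, ActsOn A (O a)) : ActsOn A (∑ a ∈ s, O a) := by
  choose M hM using h
  exact ⟨∑ a ∈ s, M a, by rw [embed_sum]; exact Finset.sum_congr rfl fun a _ => hM a⟩

/-- Only one intermediate string contributes: `A` cannot change bits outside `S`, and `B` cannot
change those in `S`. -/
theorem ActsOn.mul_apply_of_disjoint {S T : Finset (Fin n)} {A B : Op n} (hA : ActsOn S A)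
    (hB : ActsOn T B) (h : Disjoint S T) (x y : Fin n → Fin 2) :
    (A * B) x y = A x (fun i => if i ∈ S then y i else x i) *
      B (fun i => if i ∈ S then y i else x i) y := by
  rw [actsOn_iff] at hA hB
  rw [Matrix.mul_apply]
  refine Finset.sum_eq_single _ (fun z _ hz => ?_) (by simp)
  by_contra hne
  refine hz (funext fun i => ?_)
  have h₁ : i ∉ S → x i = z i := fun hi => by
    by_contra hxz; exact hne (by rw [hA.1 x z i hi hxz, zero_mul])
  have h₂ : i ∉ T → z i = y i := fun hi => by
    by_contra hzy; exact hne (by rw [hB.1 z y i hi hzy, mul_zero])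
  split_ifs with hi
  · exact h₂ (Finset.disjoint_left.1 h hi)
  · exact (h₁ hi).symm

theorem ActsOn.commute {S T : Finset (Fin n)} {A B : Op n} (hA : ActsOn S A)
    (hB : ActsOn T B) (h : Disjoint S T) : A * B = B * A := by
  ext x y
  rw [hA.mul_apply_of_disjoint hB h, hB.mul_apply_of_disjoint hA h.symm, mul_comm]
  rw [actsOn_iff] at hA hB
  have hd : ∀ i ∈ S, i ∉ T := fun i hi => Finset.disjoint_left.1 h hi
  by_cases hxy : ∀ i, i ∉ S → i ∉ T → x i = y i
  · congr 1
    · apply hB.2 <;> grind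
    · apply hA.2 <;> grind
  · push Not at hxy
    obtain ⟨i, hS, hT, hne⟩ := hxy
    rw [hB.1 _ _ i hT (by simpa [hS] using hne), hA.1 _ y i hS (by simpa [hT] using hne)]
    simp

end ActsOn

/-! ### Light cones and the spread of correlations -/

section Circuit

/-- `Ψ` is the Heisenberg picture of the superoperator `Φ`. -/
def IsDual (Φ : Module.End ℂ (Op n)) (Ψ : Op n → Op n) : Prop :=
  ∀ X Y, (Φ X * Y).trace = (X * Ψ Y).trace

/-- The dual is `Y ↦ ∑ a, k_a† Y k_a`. It is unital because the channel preserves the trace, and an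
operator supported away from `B` commutes with every Kraus operator, so it can be pulled out. -/
theorem IsGate.exists_dual {B : Finset (Fin n)} {Φ : Module.End ℂ (Op n)} (h : IsGate B Φ) :
    ∃ Ψ : Op n → Op n, IsDual Φ Ψ ∧
      (∀ S Y, B ⊆ S → ActsOn S Y → ActsOn S (Ψ Y)) ∧
      ∀ S Y, Disjoint B S → ActsOn S Y →
        Ψ Y = Y ∧ (∀ Z, Ψ (Y * Z) = Y * Ψ Z) ∧ ∀ Z, Ψ (Z * Y) = Ψ Z * Y := by
  obtain ⟨s, k, hk, hΦ⟩ := h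
  have hone : ∑ a, (embed B (k a)).conjTranspose * embed B (k a) = 1 := by
    rw [← embed_one B, ← hk, embed_sum]
    exact Finset.sum_congr rfl fun a _ => by rw [embed_mul, embed_conjTranspose]
  refine ⟨fun Y => ∑ a, (embed B (k a)).conjTranspose * Y * embed B (k a), fun X Y => ?_,
    fun S Y hS hY => ActsOn.sum fun a => ?_, fun S Y hS hY => ?_⟩
  · rw [hΦ, Finset.sum_mul, Finset.mul_sum, Matrix.trace_sum, Matrix.trace_sum]
    refine Finset.sum_congr rfl fun a _ => ?_
    rw [mul_assoc, mul_assoc, Matrix.trace_mul_comm]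
    simp only [mul_assoc]
  · have := (actsOn_embed B (k a)).mono hS
    exact (this.conjTranspose.mul hY).mul this
  · have hc : ∀ a, embed B (k a) * Y = Y * embed B (k a) := fun a =>
      (actsOn_embed B (k a)).commute hY hS
    have hc' : ∀ a, (embed B (k a)).conjTranspose * Y = Y * (embed B (k a)).conjTranspose :=
      fun a => (actsOn_embed B (k a)).conjTranspose.commute hY hS
    refine ⟨?_, fun Z => ?_, fun Z => ?_⟩
    · simp only [hc', mul_assoc]
      rw [← Finset.mul_sum, hone, mul_one]
    · rw [Finset.mul_sum]
      exact Finset.sum_congr rfl fun a _ => by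
        rw [← mul_assoc, hc' a, mul_assoc, mul_assoc, mul_assoc]
    · rw [Finset.sum_mul]
      exact Finset.sum_congr rfl fun a _ => by simp only [mul_assoc, hc a]

/-- A dual channel is not multiplicative in general. Here each block is disjoint from `S` or from
`T`, so each gate fixes one of the two factors and that factor pulls out. -/
theorem exists_dual_prod {G : Finset (Fin n) → Module.End ℂ (Op n)} (L : List (Finset (Fin n)))
    (hL : ∀ b ∈ L, IsGate b (G b)) :
    ∃ Ψ : Op n → Op n, IsDual (L.map G).prod Ψ ∧
      ∀ S T, Disjoint S T → (∀ b ∈ L, b ⊆ S ∨ Disjoint b S) → (∀ b ∈ L, b ⊆ T ∨ Disjoint b T) →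
        ∀ A B, ActsOn S A → ActsOn T B →
          ActsOn S (Ψ A) ∧ ActsOn T (Ψ B) ∧ Ψ (A * B) = Ψ A * Ψ B := by
  induction L with
  | nil => exact ⟨id, fun X Y => rfl, fun S T _ _ _ A B hA hB => ⟨hA, hB, rfl⟩⟩
  | cons b L ih =>
    obtain ⟨Ψ, hΨ, hmul⟩ := ih fun b' hb' => hL b' (List.mem_cons_of_mem b hb')
    obtain ⟨Ψb, hΨb, hin, hout⟩ := (hL b List.mem_cons_self).exists_dual
    refine ⟨Ψ ∘ Ψb, fun X Y => ?_, fun S T hST hS hT A B hA hB => ?_⟩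
    · rw [List.map_cons, List.prod_cons, Module.End.mul_apply, hΨb, hΨ, Function.comp]
    · have key : ∀ S A, (b ⊆ S ∨ Disjoint b S) → ActsOn S A → ActsOn S (Ψb A) := by
        rintro S A (h | h) hA
        · exact hin S A h hA
        · rwa [(hout S A h hA).1]
      have hbS := hS b List.mem_cons_self
      have hbT := hT b List.mem_cons_self
      have hb : Ψb (A * B) = Ψb A * Ψb B := by
        rcases hbT with h | h
        · have := hout S A (Finset.disjoint_of_subset_left h hST.symm) hA
          rw [this.2.1, this.1]
        · have := hout T B h hB
          rw [this.2.2, this.1]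
      have := hmul S T hST (fun b' hb' => hS b' (List.mem_cons_of_mem b hb'))
        (fun b' hb' => hT b' (List.mem_cons_of_mem b hb')) (Ψb A) (Ψb B) (key S A hbS hA)
        (key T B hbT hB)
      simpa only [Function.comp, hb] using this

/-- Operators on sets of qubits that are not linked by `E` are uncorrelated in the state `ρ`. -/
def Uncorrelated (E : Fin n → Fin n → Prop) (ρ : Op n) : Prop :=
  ∀ S T, (∀ p ∈ S, ∀ q ∈ T, ¬E p q) → ∀ A B, ActsOn S A → ActsOn T B →
    (ρ * (A * B)).trace = (ρ * A).trace * (ρ * B).trace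

/-- The links between qubits after a layer with blocks `P`. -/
def linkStep (P : Finpartition (Finset.univ : Finset (Fin n))) (E : Fin n → Fin n → Prop) :
    Fin n → Fin n → Prop :=
  fun p q => ∃ p' ∈ P.part p, ∃ q' ∈ P.part q, E p' q'

theorem uncorrelated_zeroState : Uncorrelated Eq (zeroState n) := by
  intro S T h A B hA hB
  have hd : Disjoint S T := Finset.disjoint_left.2 fun i hi hi' => h i hi i hi' rfl
  have htr : ∀ X : Op n, (zeroState n * X).trace = X 0 0 := fun X => by
    rw [zeroState, Matrix.trace_single_mul, one_smul]
  rw [htr, htr, htr, hA.mul_apply_of_disjoint hB hd]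
  have : (fun i => if i ∈ S then (0 : Fin n → Fin 2) i else (0 : Fin n → Fin 2) i) = 0 := by
    ext i; simp
  rw [this]

theorem subset_or_disjoint_biUnion_part (P : Finpartition (Finset.univ : Finset (Fin n)))
    (S : Finset (Fin n)) {b : Finset (Fin n)} (hb : b ∈ P.parts) :
    b ⊆ S.biUnion P.part ∨ Disjoint b (S.biUnion P.part) := by
  by_cases h : Disjoint b (S.biUnion P.part)
  · exact Or.inr h
  · left
    obtain ⟨i, hib, hi⟩ := Finset.not_disjoint_iff.1 h
    obtain ⟨p, hp, hip⟩ := Finset.mem_biUnion.1 hi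
    have : b = P.part p :=
      P.eq_of_mem_parts hb (P.part_mem.2 (Finset.mem_univ p)) hib hip
    rw [this]
    exact Finset.subset_biUnion_of_mem P.part hp

theorem subset_biUnion_part (P : Finpartition (Finset.univ : Finset (Fin n)))
    (S : Finset (Fin n)) : S ⊆ S.biUnion P.part := fun i hi =>
  Finset.mem_biUnion.2 ⟨i, hi, P.mem_part (Finset.mem_univ i)⟩

/-- In the Heisenberg picture the layer enlarges `S` and `T` to the unions of the blocks meeting
them, and `linkStep` is chosen so that these unions are unlinked by `E`. Reflexivity of `E` makes
them disjoint. -/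
theorem Uncorrelated.layer {E : Fin n → Fin n → Prop} (hE : ∀ p, E p p) {ρ : Op n}
    (h : Uncorrelated E ρ) (P : Finpartition (Finset.univ : Finset (Fin n)))
    {G : Finset (Fin n) → Module.End ℂ (Op n)} (hG : ∀ B ∈ P.parts, IsGate B (G B)) :
    Uncorrelated (linkStep P E) ((P.parts.toList.map G).prod ρ) := by
  obtain ⟨Ψ, hΨ, hmul⟩ := exists_dual_prod P.parts.toList
    fun b hb => hG b (Finset.mem_toList.1 hb)
  intro S T hST A B hA hB
  have hlink : ∀ p ∈ S.biUnion P.part, ∀ q ∈ T.biUnion P.part, ¬E p q := by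
    intro p hp q hq hpq
    obtain ⟨p', hp', hp⟩ := Finset.mem_biUnion.1 hp
    obtain ⟨q', hq', hq⟩ := Finset.mem_biUnion.1 hq
    exact hST p' hp' q' hq' ⟨p, hp, q, hq, hpq⟩
  obtain ⟨h₁, h₂, h₃⟩ := hmul (S.biUnion P.part) (T.biUnion P.part)
    (Finset.disjoint_left.2 fun i hi hi' => hlink i hi i hi' (hE i))
    (fun b hb => subset_or_disjoint_biUnion_part P S (Finset.mem_toList.1 hb))
    (fun b hb => subset_or_disjoint_biUnion_part P T (Finset.mem_toList.1 hb)) A B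
    (hA.mono (subset_biUnion_part P S)) (hB.mono (subset_biUnion_part P T))
  rw [hΨ, hΨ, hΨ, h₃]
  exact h _ _ hlink _ _ h₁ h₂

/-- The invariant `Q` is left abstract so that one induction serves both the degree count and the
distance bound. -/
theorem exists_uncorrelated {allowed : Finset (Fin n) → Prop}
    {Q : ℕ → (Fin n → Fin n → Prop) → Prop} (hzero : Q 0 Eq)
    (hstep : ∀ t E P, (∀ B ∈ Finpartition.parts P, allowed B) → Q t E → Q (t + 1) (linkStep P E))
    (L : List (Module.End ℂ (Op n))) (hL : ∀ Φ ∈ L, IsLayer allowed Φ) :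
    ∃ E, (∀ p, E p p) ∧ Q L.length E ∧ Uncorrelated E (L.prod (zeroState n)) := by
  induction L with
  | nil => exact ⟨Eq, fun _ => rfl, hzero, uncorrelated_zeroState⟩
  | cons Φ L ih =>
    obtain ⟨E, hE, hQ, hu⟩ := ih fun Φ' h => hL Φ' (List.mem_cons_of_mem Φ h)
    obtain ⟨P, G, hG, rfl⟩ := hL Φ List.mem_cons_self
    refine ⟨linkStep P E, fun p => ?_, hstep _ E P (fun B hB => (hG B hB).1) hQ, ?_⟩
    · exact ⟨p, P.mem_part (Finset.mem_univ p), p, P.mem_part (Finset.mem_univ p), hE p⟩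
    · rw [List.prod_cons, Module.End.mul_apply]
      exact hu.layer hE P fun B hB => (hG B hB).2

open Classical in
/-- Every qubit is linked by `E` to at most `D` qubits. -/
def DegreeLE (E : Fin n → Fin n → Prop) (D : ℕ) : Prop :=
  ∀ p, (Finset.univ.filter fun q => E p q).card ≤ D

theorem PreparableInDepth.exists_uncorrelated_allToAll {κ t : ℕ} {ρ : QState n}
    (h : PreparableInDepth (AllToAll κ) t ρ) :
    ∃ E, Uncorrelated E ρ.mat ∧ DegreeLE E (κ ^ (2 * t)) := by
  classical
  obtain ⟨L, rfl, hL, hρ⟩ := h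
  refine (exists_uncorrelated (Q := fun t E => DegreeLE E (κ ^ (2 * t)))
    (fun p => ?_) (fun t E P hP hE p => ?_) L hL).imp fun E h => ⟨hρ ▸ h.2.2, h.2.1⟩
  · exact Finset.card_le_one.2 (by simp +contextual)
  · have hpart : ∀ i, (P.part i).card ≤ κ := fun i => hP _ (P.part_mem.2 (Finset.mem_univ i))
    -- A new link goes from `p` within its block, along an old link, then within a second block: two
    -- factors of `κ`.
    calc (Finset.univ.filter fun q => linkStep P E p q).card
        ≤ ((P.part p).biUnion fun p' =>
            (Finset.univ.filter fun q' => E p' q').biUnion P.part).card := by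
          refine Finset.card_le_card fun q hq => ?_
          obtain ⟨p', hp', q', hq', hpq⟩ := (Finset.mem_filter.1 hq).2
          simp only [Finset.mem_biUnion, Finset.mem_filter, Finset.mem_univ, true_and]
          obtain ⟨b, hb, hq'b, hqb⟩ := P.mem_part_iff_exists.1 hq'
          exact ⟨p', hp', q', hpq, P.mem_part_iff_exists.2 ⟨b, hb, hqb, hq'b⟩⟩
      _ ≤ (P.part p).card * (κ ^ (2 * t) * κ) :=
          Finset.card_biUnion_le_card_mul _ _ _ fun p' _ =>
            (Finset.card_biUnion_le_card_mul _ _ κ fun q _ => hpart q).trans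
              (Nat.mul_le_mul_right κ (hE p'))
      _ ≤ κ * (κ ^ (2 * t) * κ) := Nat.mul_le_mul_right _ (hpart p)
      _ = κ ^ (2 * (t + 1)) := by ring

/-- Each layer moves either end of a link by at most `κ` per coordinate, so linked qubits differ by
at most `2 * κ * t`. Distinct positions reduce the count to lattice points of a box. -/
theorem PreparableInDepth.exists_uncorrelated_gridLocal {r κ t : ℕ} {pos : Fin n → Fin r → ℤ}
    (hpos : Function.Injective pos) {ρ : QState n}
    (h : PreparableInDepth (GridLocal pos κ) t ρ) :
    ∃ E, Uncorrelated E ρ.mat ∧ DegreeLE E ((4 * (κ * t) + 1) ^ r) := by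
  classical
  obtain ⟨L, rfl, hL, hρ⟩ := h
  have hstep : ∀ t E P, (∀ B ∈ Finpartition.parts P, GridLocal pos κ B) →
      (∀ p q, E p q → ∀ d, |pos p d - pos q d| ≤ 2 * (κ * (t : ℕ) : ℤ)) →
      ∀ p q, linkStep P E p q → ∀ d, |pos p d - pos q d| ≤ 2 * (κ * (t + 1 : ℕ) : ℤ) := by
    intro t E P hP hE p q hpq d
    obtain ⟨p', hp', q', hq', hpq⟩ := hpq
    have hpart : ∀ i, ∀ j ∈ P.part i, |pos i d - pos j d| ≤ κ := fun i j hj => by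
      obtain ⟨corner, hc⟩ := hP _ (P.part_mem.2 (Finset.mem_univ i))
      have h₁ := hc i (P.mem_part (Finset.mem_univ i)) d
      have h₂ := hc j hj d
      exact abs_le.2 ⟨by linarith [h₁.1, h₂.2], by linarith [h₁.2, h₂.1]⟩
    have h₁ := abs_le.1 (hpart p p' hp')
    have h₂ := abs_le.1 (hpart q q' hq')
    have h₃ := abs_le.1 (hE p' q' hpq d)
    push_cast
    exact abs_le.2 ⟨by linarith, by linarith⟩
  obtain ⟨E, -, hQ, hu⟩ := exists_uncorrelated
    (Q := fun t E => ∀ p q, E p q → ∀ d, |pos p d - pos q d| ≤ 2 * (κ * t : ℤ))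
    (fun p q h d => by simp [h]) hstep L hL
  refine ⟨E, hρ ▸ hu, fun p => ?_⟩
  calc (Finset.univ.filter fun q => E p q).card
      ≤ (Fintype.piFinset fun d => Finset.Icc (pos p d - 2 * (κ * L.length : ℤ))
          (pos p d + 2 * (κ * L.length : ℤ))).card := by
        refine Finset.card_le_card_of_injOn pos (fun q hq => ?_) hpos.injOn
        simp only [Finset.coe_filter, Finset.mem_univ, true_and, Set.mem_ofPred_eq] at hq
        simp only [Finset.mem_coe, Fintype.mem_piFinset, Finset.mem_Icc]
        intro d
        have := abs_le.1 (hQ p q hq d)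
        constructor <;> linarith [this.1, this.2]
    _ = (4 * (κ * L.length) + 1) ^ r := by
        have : ∀ d, (Finset.Icc (pos p d - 2 * (κ * L.length : ℤ))
            (pos p d + 2 * (κ * L.length : ℤ))).card = 4 * (κ * L.length) + 1 := fun d => by
          rw [Int.card_Icc]
          have : (pos p d + 2 * (κ * L.length : ℤ) + 1 - (pos p d - 2 * (κ * L.length : ℤ)))
            = ((4 * (κ * L.length) + 1 : ℕ) : ℤ) := by push_cast; ring
          rw [this, Int.toNat_natCast]
        simp [Fintype.card_piFinset, this]

end Circuit

/-! ### Fisher information and variance in the eigenbasis of the state -/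

section State

theorem norm_apply_le_l2_opNorm {ι : Type*} [Fintype ι] [DecidableEq ι] (X : Matrix ι ι ℂ)
    (i j : ι) : ‖X i j‖ ≤ ‖X‖ := by
  have h := X.l2_opNorm_mulVec (EuclideanSpace.single j (1 : ℂ))
  have h' := PiLp.norm_apply_le ((EuclideanSpace.equiv ι ℂ).symm <|
    X *ᵥ (EuclideanSpace.single j (1 : ℂ))) i
  have h'' := h'.trans h
  simpa using h''

namespace QState

/-- The eigenvalues of a state. -/
noncomputable def ev (ρ : QState n) : (Fin n → Fin 2) → ℝ := ρ.posSemidef.isHermitian.eigenvalues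

/-- The unitary matrix whose columns are the eigenvectors of a state. -/
noncomputable def U (ρ : QState n) : Op n := ρ.posSemidef.isHermitian.eigenvectorUnitary

/-- An operator in the eigenbasis of a state. -/
noncomputable def rot (ρ : QState n) (X : Op n) : Op n := star ρ.U * X * ρ.U

theorem star_U_mul_U (ρ : QState n) : star ρ.U * ρ.U = 1 :=
  Unitary.coe_star_mul_self ρ.posSemidef.isHermitian.eigenvectorUnitary

theorem U_mul_star_U (ρ : QState n) : ρ.U * star ρ.U = 1 :=
  Unitary.coe_mul_star_self ρ.posSemidef.isHermitian.eigenvectorUnitary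

theorem rot_mul (ρ : QState n) (X Y : Op n) : ρ.rot (X * Y) = ρ.rot X * ρ.rot Y := by
  have := ρ.U_mul_star_U
  calc star ρ.U * (X * Y) * ρ.U = star ρ.U * X * 1 * Y * ρ.U := by simp only [mul_one, mul_assoc]
    _ = _ := by rw [← this]; simp only [rot, mul_assoc]

theorem rot_one (ρ : QState n) : ρ.rot 1 = 1 := by
  rw [rot, mul_one, star_U_mul_U]

theorem trace_rot (ρ : QState n) (X : Op n) : (ρ.rot X).trace = X.trace := by
  rw [rot, Matrix.trace_mul_comm, ← mul_assoc, U_mul_star_U, one_mul]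

theorem isHermitian_rot (ρ : QState n) {X : Op n} (hX : X.IsHermitian) :
    (ρ.rot X).IsHermitian := by
  rw [rot, Matrix.star_eq_conjTranspose]
  exact Matrix.isHermitian_conjTranspose_mul_mul _ hX

theorem rot_mat (ρ : QState n) : ρ.rot ρ.mat = Matrix.diagonal fun i => (ρ.ev i : ℂ) := by
  have h := ρ.posSemidef.isHermitian.conjStarAlgAut_star_eigenvectorUnitary
  rw [Unitary.conjStarAlgAut_star_apply] at h
  exact h

theorem rot_apply (ρ : QState n) (X : Op n) (i j : Fin n → Fin 2) :
    star (ρ.posSemidef.isHermitian.eigenvectorBasis i).ofLp ⬝ᵥ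
      X.mulVec (ρ.posSemidef.isHermitian.eigenvectorBasis j).ofLp = ρ.rot X i j := by
  rw [rot, mul_assoc]
  rfl

theorem norm_rot_le (ρ : QState n) (X : Op n) : ‖ρ.rot X‖ ≤ ‖X‖ := by
  rw [rot, U, CStarRing.norm_mul_coe_unitary, ← Unitary.coe_star, CStarRing.norm_coe_unitary_mul]

theorem ev_nonneg (ρ : QState n) (i : Fin n → Fin 2) : 0 ≤ ρ.ev i :=
  ρ.posSemidef.eigenvalues_nonneg i

theorem trace_mat_mul (ρ : QState n) (X : Op n) :
    (ρ.mat * X).trace = ∑ i, (ρ.ev i : ℂ) * ρ.rot X i i := by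
  rw [← ρ.trace_rot, rot_mul, rot_mat, Matrix.trace]
  simp [Matrix.diagonal_mul]

theorem sum_ev (ρ : QState n) : ∑ i, ρ.ev i = 1 := by
  have h := ρ.trace_mat_mul 1
  rw [mul_one, ρ.trace_eq_one, rot_one] at h
  simp only [Matrix.one_apply_eq, mul_one] at h
  exact_mod_cast h.symm

theorem norm_trace_mul_le (ρ : QState n) (X : Op n) : ‖(ρ.mat * X).trace‖ ≤ ‖X‖ := by
  rw [trace_mat_mul]
  calc ‖∑ i, (ρ.ev i : ℂ) * ρ.rot X i i‖ ≤ ∑ i, ρ.ev i * ‖X‖ := by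
        refine norm_sum_le_of_le _ fun i _ => ?_
        rw [norm_mul, Complex.norm_real, Real.norm_of_nonneg (ρ.ev_nonneg i)]
        exact mul_le_mul_of_nonneg_left
          ((norm_apply_le_l2_opNorm _ i i).trans (ρ.norm_rot_le X)) (ρ.ev_nonneg i)
    _ = ‖X‖ := by rw [← Finset.sum_mul, sum_ev, one_mul]

theorem ofReal_re_trace_mul (ρ : QState n) {X : Op n} (hX : X.IsHermitian) :
    ((ρ.mat * X).trace.re : ℂ) = (ρ.mat * X).trace := by
  rw [← Complex.conj_eq_iff_re]
  have := Matrix.trace_conjTranspose (ρ.mat * X)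
  rw [Matrix.conjTranspose_mul, hX.eq, ρ.posSemidef.isHermitian.eq, Matrix.trace_mul_comm] at this
  exact this.symm

theorem rot_mul_rot_apply (ρ : QState n) {X : Op n} (hX : X.IsHermitian) (i j : Fin n → Fin 2) :
    ρ.rot X i j * ρ.rot X j i = ((‖ρ.rot X i j‖ ^ 2 : ℝ) : ℂ) := by
  rw [← (ρ.isHermitian_rot hX).apply j i, Complex.star_def, Complex.mul_conj,
    Complex.normSq_eq_norm_sq]

theorem norm_rot_apply_comm (ρ : QState n) {X : Op n} (hX : X.IsHermitian)
    (i j : Fin n → Fin 2) : ‖ρ.rot X i j‖ = ‖ρ.rot X j i‖ := by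
  rw [← (ρ.isHermitian_rot hX).apply j i, norm_star]

theorem trace_mul_sq (ρ : QState n) {X : Op n} (hX : X.IsHermitian) :
    (ρ.mat * (X * X)).trace = ((∑ i, ∑ j, ρ.ev i * ‖ρ.rot X i j‖ ^ 2 : ℝ) : ℂ) := by
  rw [trace_mat_mul, Complex.ofReal_sum]
  refine Finset.sum_congr rfl fun i _ => ?_
  rw [rot_mul, Matrix.mul_apply, Finset.mul_sum, Complex.ofReal_sum]
  refine Finset.sum_congr rfl fun j _ => ?_
  rw [rot_mul_rot_apply ρ hX, Complex.ofReal_mul]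

theorem trace_mul_mul_mul (ρ : QState n) {X : Op n} (hX : X.IsHermitian) :
    (ρ.mat * (X * (ρ.mat * X))).trace =
      ((∑ i, ∑ j, ρ.ev i * ρ.ev j * ‖ρ.rot X i j‖ ^ 2 : ℝ) : ℂ) := by
  rw [trace_mat_mul, Complex.ofReal_sum]
  refine Finset.sum_congr rfl fun i _ => ?_
  rw [rot_mul, Matrix.mul_apply, Finset.mul_sum, Complex.ofReal_sum]
  refine Finset.sum_congr rfl fun j _ => ?_
  rw [rot_mul, rot_mat, Matrix.diagonal_mul, mul_left_comm (ρ.rot X i j),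
    rot_mul_rot_apply ρ hX]
  push_cast
  ring

end QState

theorem qfi_eq (ρ : QState n) (O : Op n) :
    qfi ρ O = 1 / 2 * ∑ i, ∑ j, if ρ.ev i + ρ.ev j ≠ 0 then
      (ρ.ev i - ρ.ev j) ^ 2 / (ρ.ev i + ρ.ev j) * ‖ρ.rot O i j‖ ^ 2 else 0 := by
  simp only [← QState.rot_apply]
  rfl

/-- The variance of `O` in the state `ρ`. -/
noncomputable def variance (ρ : QState n) (O : Op n) : ℝ :=
  ((ρ.mat * (O * O)).trace - (ρ.mat * O).trace * (ρ.mat * O).trace).re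

/-- Centring `O` changes only diagonal entries, whose weight in the Fisher information is zero. The
variance, symmetrised in `i, j`, has weights `λ_i + λ_j ≥ (λ_i - λ_j) ^ 2 / (λ_i + λ_j)`. -/
theorem qfi_le_variance (ρ : QState n) {O : Op n} (hO : O.IsHermitian) :
    qfi ρ O ≤ variance ρ O := by
  set h : ℝ := (ρ.mat * O).trace.re with hh
  set X : Op n := O - (h : ℂ) • 1 with hXdef
  have hX : X.IsHermitian := by
    refine hO.sub ?_
    rw [Matrix.IsHermitian, Matrix.conjTranspose_smul, Matrix.conjTranspose_one]
    simp
  have hrot : ∀ i j, i ≠ j → ρ.rot O i j = ρ.rot X i j := by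
    intro i j hij
    have : ρ.rot X = ρ.rot O - (h : ℂ) • 1 := by
      rw [← ρ.rot_one, hXdef]
      simp [QState.rot, mul_sub, sub_mul]
    rw [this]
    simp [hij]
  have hvar : variance ρ O = ∑ i, ∑ j, ρ.ev i * ‖ρ.rot X i j‖ ^ 2 := by
    have h₁ := ρ.trace_mul_sq hX
    have h₂ : (ρ.mat * (X * X)).trace =
        (ρ.mat * (O * O)).trace - (ρ.mat * O).trace * (ρ.mat * O).trace := by
      have : ρ.mat * (X * X) =
          ρ.mat * (O * O) - (2 * h : ℂ) • (ρ.mat * O) + (h * h : ℂ) • ρ.mat := by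
        rw [hXdef]
        simp only [mul_sub, sub_mul, Algebra.mul_smul_comm, Algebra.smul_mul_assoc, mul_one,
          one_mul, smul_smul, two_mul, add_smul, smul_sub]
        abel
      rw [this, Matrix.trace_add, Matrix.trace_sub, Matrix.trace_smul, Matrix.trace_smul,
        ρ.trace_eq_one, hh, ρ.ofReal_re_trace_mul hO, smul_eq_mul, smul_eq_mul]
      ring
    rw [variance, ← h₂, h₁, Complex.ofReal_re]
  have hsymm : ∑ i, ∑ j, ρ.ev i * ‖ρ.rot X i j‖ ^ 2 =
      1 / 2 * ∑ i, ∑ j, (ρ.ev i + ρ.ev j) * ‖ρ.rot X i j‖ ^ 2 := by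
    have : ∑ i, ∑ j, ρ.ev j * ‖ρ.rot X i j‖ ^ 2 = ∑ i, ∑ j, ρ.ev i * ‖ρ.rot X i j‖ ^ 2 := by
      rw [Finset.sum_comm]
      exact Finset.sum_congr rfl fun i _ => Finset.sum_congr rfl fun j _ => by
        rw [ρ.norm_rot_apply_comm hX]
    simp only [add_mul, Finset.sum_add_distrib, this]
    ring
  rw [hvar, hsymm, qfi_eq]
  refine mul_le_mul_of_nonneg_left (Finset.sum_le_sum fun i _ => Finset.sum_le_sum fun j _ => ?_)
    (by norm_num)
  have hi := ρ.ev_nonneg i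
  have hj := ρ.ev_nonneg j
  split_ifs with hne
  · rcases eq_or_ne i j with rfl | hij
    · simp only [sub_self, ne_eq, OfNat.ofNat_ne_zero, not_false_eq_true, zero_pow, zero_div,
        zero_mul]
      positivity
    · rw [hrot i j hij]
      refine mul_le_mul_of_nonneg_right ?_ (by positivity)
      rw [div_le_iff₀ (lt_of_le_of_ne (add_nonneg hi hj) hne.symm)]
      nlinarith [mul_nonneg hi hj]
  · positivity

theorem qfi_eq_of_isIdempotentElem (ρ : QState n) (hρ : ρ.mat * ρ.mat = ρ.mat) {O : Op n}
    (hO : O.IsHermitian) :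
    qfi ρ O = ((ρ.mat * (O * O)).trace - (ρ.mat * (O * (ρ.mat * O))).trace).re := by
  have hev : ∀ i, ρ.ev i = 0 ∨ ρ.ev i = 1 := fun i => by
    have h := ρ.rot_mul ρ.mat ρ.mat
    rw [hρ, ρ.rot_mat, Matrix.diagonal_mul_diagonal] at h
    have h' : ((ρ.ev i : ℂ)) = ρ.ev i * ρ.ev i := congrFun (Matrix.diagonal_injective h) i
    have h'' : ρ.ev i * (1 - ρ.ev i) = 0 := by
      rw [mul_sub, mul_one, sub_eq_zero]; exact_mod_cast h'
    rcases mul_eq_zero.1 h'' with h | h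
    · exact Or.inl h
    · exact Or.inr (by linarith)
  have hsymm : ∑ i, ∑ j, ρ.ev j * ‖ρ.rot O i j‖ ^ 2 = ∑ i, ∑ j, ρ.ev i * ‖ρ.rot O i j‖ ^ 2 := by
    rw [Finset.sum_comm]
    exact Finset.sum_congr rfl fun i _ => Finset.sum_congr rfl fun j _ => by
      rw [ρ.norm_rot_apply_comm hO]
  -- For eigenvalues in `{0, 1}` the weight equals `λ_i + λ_j - 2 λ_i λ_j`.
  have hterm : ∀ i j, (if ρ.ev i + ρ.ev j ≠ 0 then
      (ρ.ev i - ρ.ev j) ^ 2 / (ρ.ev i + ρ.ev j) * ‖ρ.rot O i j‖ ^ 2 else 0) =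
      ρ.ev i * ‖ρ.rot O i j‖ ^ 2 + ρ.ev j * ‖ρ.rot O i j‖ ^ 2
        - 2 * (ρ.ev i * ρ.ev j * ‖ρ.rot O i j‖ ^ 2) := fun i j => by
    rcases hev i with hi | hi <;> rcases hev j with hj | hj <;> (simp [hi, hj]; try ring)
  rw [qfi_eq, ρ.trace_mul_sq hO, ρ.trace_mul_mul_mul hO, ← Complex.ofReal_sub, Complex.ofReal_re]
  simp only [hterm, Finset.sum_sub_distrib, Finset.sum_add_distrib, hsymm, ← Finset.mul_sum]
  ring

end State

/-! ### A state with large Fisher information -/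

section Superposition

theorem dotProduct_eigenvectorBasis {O : Op n} (hO : O.IsHermitian) (i j : Fin n → Fin 2) :
    star (hO.eigenvectorBasis i).ofLp ⬝ᵥ (hO.eigenvectorBasis j).ofLp = if i = j then 1 else 0 := by
  rw [dotProduct_comm, ← EuclideanSpace.inner_eq_star_dotProduct,
    orthonormal_iff_ite.1 hO.eigenvectorBasis.orthonormal i j]

/-- The equal superposition of two eigenvectors of `O`, as a state. -/
noncomputable def superposition {O : Op n} (hO : O.IsHermitian) {i j : Fin n → Fin 2}
    (hij : i ≠ j) : QState n where
  mat := (1 / 2 : ℂ) • vecMulVec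
    ((hO.eigenvectorBasis i).ofLp + (hO.eigenvectorBasis j).ofLp)
    (star ((hO.eigenvectorBasis i).ofLp + (hO.eigenvectorBasis j).ofLp))
  posSemidef := (posSemidef_vecMulVec_self_star _).smul (by norm_num [Complex.le_def])
  trace_eq_one := by
    rw [trace_smul, trace_vecMulVec, dotProduct_comm, star_add, add_dotProduct, dotProduct_add,
      dotProduct_add]
    simp only [dotProduct_eigenvectorBasis, hij, hij.symm, if_true, if_false]
    norm_num

theorem trace_superposition_mul {O : Op n} (hO : O.IsHermitian) {i j : Fin n → Fin 2}
    (hij : i ≠ j) (X : Op n) :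
    ((superposition hO hij).mat * X).trace = 1 / 2 *
      (star ((hO.eigenvectorBasis i).ofLp + (hO.eigenvectorBasis j).ofLp) ⬝ᵥ
        X *ᵥ ((hO.eigenvectorBasis i).ofLp + (hO.eigenvectorBasis j).ofLp)) := by
  rw [superposition, smul_mul_assoc, vecMulVec_mul, trace_smul, trace_vecMulVec, dotProduct_comm,
    dotProduct_mulVec, smul_eq_mul]

/-- This holds because the state has rank one; `X = 1` gives idempotence. -/
theorem superposition_mul_mul {O : Op n} (hO : O.IsHermitian) {i j : Fin n → Fin 2}
    (hij : i ≠ j) (X : Op n) :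
    (superposition hO hij).mat * (X * (superposition hO hij).mat) =
      ((superposition hO hij).mat * X).trace • (superposition hO hij).mat := by
  rw [trace_superposition_mul, superposition, mul_smul_comm, mul_smul_comm, smul_mul_assoc,
    mul_vecMulVec, vecMulVec_mul_vecMulVec, smul_smul, smul_smul, vecMulVec_smul, smul_smul]
  congr 1
  ring

theorem qfi_superposition {O : Op n} (hO : O.IsHermitian) {i j : Fin n → Fin 2} (hij : i ≠ j) :
    qfi (superposition hO hij) O = (hO.eigenvalues i - hO.eigenvalues j) ^ 2 / 4 := by
  have hmul : ∀ k, O *ᵥ (hO.eigenvectorBasis k).ofLp =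
      (hO.eigenvalues k : ℂ) • (hO.eigenvectorBasis k).ofLp := fun k =>
    hO.mulVec_eigenvectorBasis k
  rw [qfi_eq_of_isIdempotentElem _ ?_ hO]
  · rw [← mul_assoc O, ← mul_assoc _ (O * _), superposition_mul_mul, smul_mul_assoc, trace_smul,
      trace_superposition_mul, trace_superposition_mul, ← mulVec_mulVec]
    simp only [mulVec_add, mulVec_smul, hmul, star_add, add_dotProduct, dotProduct_add,
      dotProduct_smul, dotProduct_eigenvectorBasis, hij, hij.symm, if_true, if_false]
    have : ∀ a b : ℝ, (1 / 2 * ((a : ℂ) * a + b * 0 + (a * 0 + b * b)) -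
        1 / 2 * (a + b * 0 + (a * 0 + b)) * (1 / 2 * (a + b * 0 + (a * 0 + b)))) =
        (((a - b) ^ 2 / 4 : ℝ) : ℂ) := fun a b => by push_cast; ring
    rw [← Complex.ofReal_re ((hO.eigenvalues i - hO.eigenvalues j) ^ 2 / 4), ← this]
    simp
  · have h := superposition_mul_mul hO hij 1
    rwa [one_mul, mul_one, (superposition hO hij).trace_eq_one, one_smul] at h

end Superposition

/-! ### Variance bound and comparison with optimality -/

section Bound

theorem variance_le {K D : ℕ} (H : LocalHamiltonian K n) (ρ : QState n)
    {E : Fin n → Fin n → Prop} (hu : Uncorrelated E ρ.mat) (hD : DegreeLE E D) :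
    variance ρ H.op ≤ 2 * K ^ 2 * D * H.m := by
  classical
  set cov : Fin H.m → Fin H.m → ℂ := fun i j => (ρ.mat * (H.term i * H.term j)).trace -
    (ρ.mat * H.term i).trace * (ρ.mat * H.term j).trace with hcov
  have hvar : variance ρ H.op = (∑ i, ∑ j, cov i j).re := by
    rw [variance]
    congr 1
    rw [LocalHamiltonian.op, Finset.sum_mul_sum]
    simp only [hcov, Finset.sum_sub_distrib, Finset.mul_sum, Matrix.trace_sum]
    rw [← Finset.mul_sum, Finset.sum_mul_sum]
  have hnorm : ∀ i, ‖(ρ.mat * H.term i).trace‖ ≤ 1 := fun i =>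
    (ρ.norm_trace_mul_le _).trans (H.norm_term_le i)
  have hnorm' : ∀ i j, ‖cov i j‖ ≤ 2 := fun i j => by
    have h₁ : ‖(ρ.mat * (H.term i * H.term j)).trace‖ ≤ 1 :=
      (ρ.norm_trace_mul_le _).trans <| (norm_mul_le _ _).trans <|
        mul_le_one₀ (H.norm_term_le i) (norm_nonneg _) (H.norm_term_le j)
    have h₂ : ‖(ρ.mat * H.term i).trace * (ρ.mat * H.term j).trace‖ ≤ 1 := by
      rw [norm_mul]
      exact mul_le_one₀ (hnorm i) (norm_nonneg _) (hnorm j)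
    exact (norm_sub_le _ _).trans (by linarith)
  -- At most `K` qubits in the support, `D` links from each, and `K` terms at each linked qubit.
  set linked : Fin H.m → Finset (Fin H.m) := fun i => (supp (H.term i)).biUnion fun p =>
    (Finset.univ.filter fun q => E p q).biUnion fun q =>
      Finset.univ.filter fun j => q ∈ supp (H.term j) with hlinked
  have hcard : ∀ i, (linked i).card ≤ K * (D * K) := fun i =>
    (Finset.card_biUnion_le_card_mul _ _ (D * K) fun p _ =>
      (Finset.card_biUnion_le_card_mul _ _ K fun q _ => H.degree_le q).trans
        (Nat.mul_le_mul_right K (hD p))).trans (Nat.mul_le_mul_right _ (H.card_supp_le i))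
  have hzero : ∀ i j, j ∉ linked i → cov i j = 0 := fun i j hj => by
    refine sub_eq_zero.2 (hu _ _ (fun p hp q hq hpq => hj ?_) _ _ (actsOn_supp (H.term i))
      (actsOn_supp (H.term j)))
    simp only [hlinked, Finset.mem_biUnion, Finset.mem_filter, Finset.mem_univ, true_and]
    exact ⟨p, hp, q, hpq, hq⟩
  have hrow : ∀ i, ‖∑ j, cov i j‖ ≤ 2 * K ^ 2 * D := fun i => by
    rw [← Finset.sum_subset (Finset.subset_univ (linked i)) fun j _ hj => hzero i j hj]
    calc ‖∑ j ∈ linked i, cov i j‖ ≤ ∑ j ∈ linked i, (2 : ℝ) :=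
          norm_sum_le_of_le _ fun j _ => hnorm' i j
      _ = (linked i).card * 2 := by rw [Finset.sum_const, nsmul_eq_mul]
      _ ≤ (K * (D * K) : ℕ) * 2 := by gcongr; exact hcard i
      _ = 2 * K ^ 2 * D := by push_cast; ring
  calc variance ρ H.op ≤ ‖∑ i, ∑ j, cov i j‖ := hvar ▸ Complex.re_le_norm _
    _ ≤ ∑ _i : Fin H.m, 2 * (K : ℝ) ^ 2 * D := norm_sum_le_of_le _ fun i _ => hrow i
    _ = 2 * K ^ 2 * D * H.m := by
      rw [Finset.sum_const, nsmul_eq_mul, Finset.card_univ, Fintype.card_fin, mul_comm]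

theorem HasOptimalQFI.le_qfi {K : ℕ} {c : ℝ} (hc : 0 < c) (hn : 1 ≤ n)
    {H : LocalHamiltonian K n} {ρ : QState n} (h : HasOptimalQFI c H ρ) :
    min c (c ^ 2 / 4) * (n : ℝ) ^ 2 ≤ qfi ρ H.op := by
  have hn' : (0 : ℝ) < n := by exact_mod_cast hn
  rcases h with h | ⟨⟨i, j, hw⟩, hmax⟩
  · exact (mul_le_mul_of_nonneg_right (min_le_left _ _) (sq_nonneg _)).trans h
  · have hpos : 0 < c * n := mul_pos hc hn'
    have hij : i ≠ j := by
      rintro rfl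
      linarith
    have h₁ := hmax (superposition H.isHermitian_op hij)
    rw [qfi_superposition] at h₁
    calc min c (c ^ 2 / 4) * (n : ℝ) ^ 2 ≤ c ^ 2 / 4 * (n : ℝ) ^ 2 :=
          mul_le_mul_of_nonneg_right (min_le_right _ _) (sq_nonneg _)
      _ = (c * n) ^ 2 / 4 := by ring
      _ ≤ _ := by gcongr
      _ ≤ _ := h₁

theorem exists_card_le_mul_degree (K : ℕ) (C c : ℝ) (hc : 0 < c) :
    ∃ A : ℝ, 1 ≤ A ∧ ∀ n : ℕ, 1 ≤ n → ∀ H : LocalHamiltonian K n, (H.m : ℝ) ≤ C * n →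
      ∀ ρ : QState n, HasOptimalQFI c H ρ → ∀ E D, Uncorrelated E ρ.mat → DegreeLE E D →
        (n : ℝ) ≤ A * D := by
  have hc' : 0 < min c (c ^ 2 / 4) := lt_min hc (by positivity)
  -- The maximum with `1` keeps `A` positive whatever the values of `K` and `C`.
  refine ⟨max 1 (2 * K ^ 2 * C / min c (c ^ 2 / 4)), le_max_left _ _,
    fun n hn H hm ρ hρ E D hu hD => ?_⟩
  have hn' : (0 : ℝ) < n := by exact_mod_cast hn
  have h : min c (c ^ 2 / 4) * (n : ℝ) ^ 2 ≤ 2 * K ^ 2 * D * (C * n) :=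
    (hρ.le_qfi hc hn).trans <| (qfi_le_variance ρ H.isHermitian_op).trans <|
      (variance_le H ρ hu hD).trans (by gcongr)
  have h' : (n : ℝ) ≤ 2 * K ^ 2 * C / min c (c ^ 2 / 4) * D := by
    rw [div_mul_eq_mul_div, le_div_iff₀ hc']
    nlinarith
  exact h'.trans (mul_le_mul_of_nonneg_right (le_max_right _ _) (Nat.cast_nonneg D))

/-- Depths are integers, so `x` may be rounded up; if no circuit exists the infimum is `⊤`. -/
theorem ofReal_le_circuitComplexity {allowed : Finset (Fin n) → Prop} {ρ : QState n} {x : ℝ}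
    (h : ∀ t : ℕ, PreparableInDepth allowed t ρ → x ≤ t) :
    ENNReal.ofReal x ≤ (circuitComplexity allowed ρ : ℝ≥0∞) := by
  have h₁ : ((⌈x⌉₊ : ℕ) : ℕ∞) ≤ circuitComplexity allowed ρ :=
    le_iInf₂ fun t ht => Nat.cast_le.2 (Nat.ceil_le.2 (h t ht))
  calc ENNReal.ofReal x ≤ ENNReal.ofReal (⌈x⌉₊ : ℕ) := ENNReal.ofReal_le_ofReal (Nat.le_ceil x)
    _ = (((⌈x⌉₊ : ℕ) : ℕ∞) : ℝ≥0∞) := by simp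
    _ ≤ _ := ENat.toENNReal_le.2 h₁

end Bound

end Metrology

/-! ### Solving for the depth -/

theorem mainTheorem6 (K κ : ℕ) (C c : ℝ) (hc : 0 < c) :
    (∃ a : ℝ, 0 < a ∧ ∃ n₀ : ℕ, ∀ n : ℕ, n₀ ≤ n →
      ∀ H : Metrology.LocalHamiltonian K n, (H.m : ℝ) ≤ C * n →
      ∀ ρ : Metrology.QState n, Metrology.HasOptimalQFI c H ρ →
        ENNReal.ofReal (a * Real.log n) ≤
          (Metrology.circuitComplexity (Metrology.AllToAll κ) ρ : ℝ≥0∞)) ∧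
    (∀ r : ℕ, 1 ≤ r → ∃ a : ℝ, 0 < a ∧ ∃ n₀ : ℕ, ∀ n : ℕ, n₀ ≤ n →
      ∀ pos : Fin n → Fin r → ℤ, Function.Injective pos →
      ∀ H : Metrology.LocalHamiltonian K n, (H.m : ℝ) ≤ C * n →
      ∀ ρ : Metrology.QState n, Metrology.HasOptimalQFI c H ρ →
        ENNReal.ofReal (a * (n : ℝ) ^ (1 / (r : ℝ))) ≤
          (Metrology.circuitComplexity (Metrology.GridLocal pos κ) ρ : ℝ≥0∞)) := by
  obtain ⟨A, hA, hmain⟩ := Metrology.exists_card_le_mul_degree K C c hc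
  have hA₀ : 0 < A := one_pos.trans_le hA
  constructor
  · have hκ : 0 < Real.log (κ + 2) := Real.log_pos (by have := κ.cast_nonneg (α := ℝ); linarith)
    -- `A ^ 2 ≤ n` lets `log A` absorb at most half of `log n`, leaving `log n / 2 ≤ 2 * t * log (κ
    -- + 2)`. Using `κ + 2` keeps the logarithm positive for `κ = 0, 1`.
    refine ⟨1 / (4 * Real.log (κ + 2)), by positivity, max 1 ⌈A ^ 2⌉₊, fun n hn H hm ρ hρ =>
      Metrology.ofReal_le_circuitComplexity fun t ht => ?_⟩
    obtain ⟨E, hu, hD⟩ := ht.exists_uncorrelated_allToAll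
    have hn₁ : 1 ≤ n := (le_max_left _ _).trans hn
    have hn₂ : A ^ 2 ≤ n := Nat.ceil_le.1 ((le_max_right _ _).trans hn)
    have hn' : (0 : ℝ) < n := by exact_mod_cast hn₁
    have h₁ : (n : ℝ) ≤ A * (κ + 2 : ℝ) ^ (2 * t) := by
      refine (hmain n hn₁ H hm ρ hρ E _ hu hD).trans ?_
      push_cast
      gcongr
      linarith
    have h₂ := Real.log_le_log hn' h₁
    rw [Real.log_mul hA₀.ne' (by positivity), Real.log_pow] at h₂
    have h₃ := Real.log_le_log (by positivity) hn₂
    rw [Real.log_pow] at h₃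
    push_cast at h₂ h₃
    rw [one_div_mul_eq_div, div_le_iff₀ (by positivity)]
    linarith
  · intro r hr
    have hr' : (r : ℝ) ≠ 0 := by exact_mod_cast (Nat.one_le_iff_ne_zero.1 hr)
    -- The threshold forces `A < n`, which rules out `t = 0` (where `D = 1`); for `t ≥ 1`, `4 * κ *
    -- t + 1 ≤ (4 * κ + 1) * t`.
    refine ⟨1 / (A ^ (1 / (r : ℝ)) * (4 * κ + 1)), by positivity, ⌊A⌋₊ + 1,
      fun n hn pos hpos H hm ρ hρ => Metrology.ofReal_le_circuitComplexity fun t ht => ?_⟩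
    obtain ⟨E, hu, hD⟩ := ht.exists_uncorrelated_gridLocal hpos
    have h₁ := hmain n (by omega) H hm ρ hρ E _ hu hD
    have hn' : A < n := (Nat.floor_lt hA₀.le).1 hn
    have ht : 1 ≤ t := by
      by_contra h
      obtain rfl : t = 0 := by omega
      simp at h₁
      linarith
    have ht' : (1 : ℝ) ≤ t := by exact_mod_cast ht
    have h₂ : (n : ℝ) ≤ A * ((4 * κ + 1) * t) ^ r := by
      refine h₁.trans ?_
      push_cast
      gcongr
      linarith
    have h₃ : (n : ℝ) ^ (1 / (r : ℝ)) ≤ A ^ (1 / (r : ℝ)) * ((4 * κ + 1) * t) := by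
      refine (Real.rpow_le_rpow (Nat.cast_nonneg n) h₂ (by positivity)).trans_eq ?_
      rw [Real.mul_rpow hA₀.le (by positivity), ← Real.rpow_natCast, ← Real.rpow_mul (by positivity),
        mul_one_div_cancel hr', Real.rpow_one]
    rw [one_div_mul_eq_div, div_le_iff₀ (by positivity)]
    linarith
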